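/- Let $\mathbb{K}$ be a field. A finite hypergraph $\mathcal{H}=(V,E)$ consists of a finite set $V$ of vertices and a set $E$ of subsets of $V$ (edges), none of which is properly contained in another; $I_{\mathcal{H}}$ is the ideal of $A=\mathbb{K}[x_v : v\in V]$ generated by the monomials $\prod_{v\in\varepsilon}x_v$, $\varepsilon\in E$. The card $\mathcal{H}-v$ is the hypergraph with vertex set $V\setminus\{v\}$ whose edges are the edges of $\mathcal{H}$ not containing $v$. Two hypergraphs $\mathcal{H}$, $\mathcal{H}'$ have the same deck if there is a bijection $\sigma:V\to V'$ such that $\mathcal{H}-v$ and $\mathcal{H}'-\sigma(v)$ are isomorphic for all $v\in V$. For $R=A/I_{\mathcal{H}}\neq 0$ of Krull dimension $d$, the multiplicity of $R$ is $e(R)=Q(1)$, where $\sum_{i\ge 0}\dim_{\mathbb{K}}(R_i)\,t^i=Q(t)/(1-t)^d$ with $Q\in\mathbb{Z}[t]$; put $e(0)=0$. **Corollary 4.6.** Let $\mathcal{H}=(V,E)$ be a hypergraph on $n\ge 3$ vertices with $E\neq\emptyset$ and $E\neq\{V\}$. Then the Krull dimension and the multiplicity of $R=A/I_{\mathcal{H}}$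 are reconstructible: the multiplicity is well defined, and if $\mathcal{H}'$ is any finite hypergraph with the same deck as $\mathcal{H}$, then $A/I_{\mathcal{H}}$ and $A'/I_{\mathcal{H}'}$, where $A'=\mathbb{K}[x_w : w\in V']$ and $V'$ is the vertex set of $\mathcal{H}'$, have the same Krull dimension and the same multiplicity. -/

import Mathlib

open MvPolynomial

/-- A hypergraph on the vertex set `V`: a set of edges, each a set of vertices, such that no edge is
properly contained in another. (Mathlib's `Hypergraph` does not have this last condition.)
Only finite `V` is considered. -/
@[ext]
structure SimpleHypergraph (V : Type*) where
  /-- The set of edges. -/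
  edges : Set (Finset V)
  /-- An edge contained in another edge is equal to it. -/
  eq_of_subset : ∀ e₁ ∈ edges, ∀ e₂ ∈ edges, e₁ ⊆ e₂ → e₁ = e₂

namespace SimpleHypergraph

variable {V : Type*} {V' : Type*}

/-- The vertex-induced subhypergraph on `W`: its vertices are the elements of `W`, its edges are all
the edges of `H` that are contained in `W`. -/
def induce (H : SimpleHypergraph V) (W : Set V) : SimpleHypergraph W where
  edges := {e | e.map (Function.Embedding.subtype (· ∈ W)) ∈ H.edges}
  eq_of_subset _ h₁ _ h₂ h :=
    Finset.map_injective _ (H.eq_of_subset _ h₁ _ h₂ (Finset.map_subset_map.2 h))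

/-- The card `H - v`: the vertex-induced subhypergraph on all the vertices other than `v`. -/
def deleteVertex (H : SimpleHypergraph V) (v : V) : SimpleHypergraph ({v}ᶜ : Set V) :=
  H.induce {v}ᶜ

/-- Isomorphic hypergraphs: there is a bijection of the vertex sets under which edges correspond
to edges. -/
def IsIsomorphic (H : SimpleHypergraph V) (H' : SimpleHypergraph V') : Prop :=
  ∃ φ : V ≃ V', ∀ e : Finset V, e.map φ.toEmbedding ∈ H'.edges ↔ e ∈ H.edges

/-- Two hypergraphs have the same deck if their decks `(H - v)_v` and `(H' - w)_w` are the same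
collection of hypergraphs (with repetition) up to isomorphism of the cards. -/
def SameDeck (H : SimpleHypergraph V) (H' : SimpleHypergraph V') : Prop :=
  ∃ σ : V ≃ V', ∀ v : V, (H.deleteVertex v).IsIsomorphic (H'.deleteVertex (σ v))

section Algebra

variable (K : Type*) [Field K] (H : SimpleHypergraph V)

/-- The ideal `I_H` of `A = K[x_v : v ∈ V]` generated by the squarefree monomials `∏_{v ∈ ε} x_v`,
where `ε` runs over the edges. -/
noncomputable def edgeIdeal : Ideal (MvPolynomial V K) :=
  Ideal.span {p | ∃ e ∈ H.edges, p = ∏ v ∈ e, X v}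

/-- The ring `R = A / I_H`. -/
abbrev EdgeRing : Type _ := MvPolynomial V K ⧸ H.edgeIdeal K

/-- The degree `i` component `R_i` of `R = A / I_H`: the image of the space of homogeneous
polynomials of degree `i`. -/
noncomputable def gradedPiece (i : ℕ) : Submodule K (H.EdgeRing K) :=
  (homogeneousSubmodule V K i).map (Ideal.Quotient.mkₐ K (H.edgeIdeal K)).toLinearMap

/-- The Hilbert series `∑ i, dim_K (R_i) t ^ i` of `R = A / I_H`. -/
noncomputable def hilbertSeries : PowerSeries ℤ :=
  PowerSeries.mk fun i => (Module.finrank K (H.gradedPiece K i) : ℤ)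

/-- `e` is the multiplicity of `R = A / I_H`: if `d` is the Krull dimension of `R`, then the Hilbert
series of `R` is `Q(t) / (1 - t) ^ d` for a polynomial `Q` with integer coefficients, and
`e = Q(1)`. The multiplicity of the zero ring is `0`. -/
def IsMultiplicity (e : ℤ) : Prop :=
  (Subsingleton (H.EdgeRing K) ∧ e = 0) ∨
    ∃ d : ℕ, ringKrullDim (H.EdgeRing K) = d ∧
      ∃ Q : Polynomial ℤ,
        (1 - PowerSeries.X) ^ d * H.hilbertSeries K = (Q : PowerSeries ℤ) ∧ e = Q.eval 1

end Algebra

end SimpleHypergraph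

namespace SimpleHypergraph

open Finset

variable {V : Type*} {V' : Type*}

/-! Everything is read off from the numbers `f_i` of faces with `i` elements. A monomial is nonzero
in `R` exactly when its support is a face, so grouping monomials by support gives the Hilbert series
`∑ f_j (t/(1-t))^j` (`hilbertSeries_eq`). The Krull dimension of a nonzero `R` is the largest size
of a face (`ringKrullDim_edgeRing_eq`), and `R = 0` exactly when there are no faces.

The `f_i` are reconstructible (`SameDeck.faceNumber_eq`): for `i < n`, Kelly's double counting
recovers `f_i` from the cards; for `i = n` both sides are zero, because both hypergraphs have an
edge. -/

/-- A face of `H` is a finite set of vertices which contains no edge. -/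
def IsFace (H : SimpleHypergraph V) (F : Finset V) : Prop :=
  ∀ e ∈ H.edges, ¬ e ⊆ F

/-- The number of faces of `H` with `i` elements. -/
noncomputable def faceNumber (H : SimpleHypergraph V) (i : ℕ) : ℕ :=
  {F : Finset V | H.IsFace F ∧ #F = i}.ncard

lemma IsFace.mono {H : SimpleHypergraph V} {F G : Finset V} (hG : H.IsFace G) (h : F ⊆ G) :
    H.IsFace F :=
  fun e he hF => hG e he (hF.trans h)

/-! ### Face numbers are determined by the deck. -/

section Reconstruction

lemma IsIsomorphic.faceNumber_eq {H : SimpleHypergraph V} {H' : SimpleHypergraph V'}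
    (h : H.IsIsomorphic H') (i : ℕ) : H.faceNumber i = H'.faceNumber i := by
  obtain ⟨φ, hφ⟩ := h
  have key : ∀ F : Finset V, H'.IsFace (F.map φ.toEmbedding) ↔ H.IsFace F := by
    refine fun F => ⟨fun h e he hF => h _ ((hφ e).2 he) (map_subset_map.2 hF),
      fun h e he hF => ?_⟩
    obtain ⟨e, rfl⟩ : ∃ e₀ : Finset V, e₀.map φ.toEmbedding = e :=
      ⟨e.map φ.symm.toEmbedding, by ext; simp⟩
    exact h e ((hφ e).1 he) (map_subset_map.1 hF)
  have himage : {F : Finset V' | H'.IsFace F ∧ #F = i} =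
      (Finset.map φ.toEmbedding) '' {F : Finset V | H.IsFace F ∧ #F = i} := by
    ext F
    simp only [Set.mem_ofPred_eq, Set.mem_image]
    constructor
    · rintro ⟨hF, hi⟩
      have hmap : (F.map φ.symm.toEmbedding).map φ.toEmbedding = F := by ext; simp
      exact ⟨F.map φ.symm.toEmbedding, ⟨(key _).1 (by rwa [hmap]), by simpa⟩, hmap⟩
    · rintro ⟨F, ⟨hF, hi⟩, rfl⟩
      exact ⟨(key _).2 hF, by simpa⟩
  rw [faceNumber, faceNumber, himage, Set.ncard_image_of_injective _ (Finset.map_injective _)]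

lemma isFace_deleteVertex (H : SimpleHypergraph V) (v : V) (F : Finset ({v}ᶜ : Set V)) :
    (H.deleteVertex v).IsFace F ↔
      H.IsFace (F.map (Function.Embedding.subtype (· ∈ ({v}ᶜ : Set V)))) := by
  classical
  refine ⟨fun h e he hF => ?_, fun h e he hF => h _ he (map_subset_map.2 hF)⟩
  obtain ⟨e, heF, rfl⟩ := subset_map_iff.1 hF
  exact h e he heF

lemma faceNumber_deleteVertex (H : SimpleHypergraph V) (v : V) (i : ℕ) :
    (H.deleteVertex v).faceNumber i =
      {F : Finset V | (H.IsFace F ∧ #F = i) ∧ v ∉ F}.ncard := by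
  classical
  rw [faceNumber, ← Set.ncard_image_of_injective _
    (Finset.map_injective (Function.Embedding.subtype (· ∈ ({v}ᶜ : Set V))))]
  congr 1
  ext F
  simp only [Set.mem_ofPred_eq, Set.mem_image, isFace_deleteVertex]
  constructor
  · rintro ⟨F, ⟨hF, hi⟩, rfl⟩
    exact ⟨⟨hF, by simpa⟩, by simp⟩
  · rintro ⟨⟨hF, hi⟩, hv⟩
    have hmap : (F.subtype (· ∈ ({v}ᶜ : Set V))).map
        (Function.Embedding.subtype (· ∈ ({v}ᶜ : Set V))) = F :=
      subtype_map_of_mem fun x hx => by rintro rfl; exact hv hx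
    exact ⟨_, ⟨by rwa [hmap], by rw [← hi, ← card_map, hmap]⟩, hmap⟩

/-- Kelly's counting argument for faces. -/
lemma sum_faceNumber_deleteVertex [Fintype V] (H : SimpleHypergraph V) (i : ℕ) :
    ∑ v, (H.deleteVertex v).faceNumber i = (Fintype.card V - i) * H.faceNumber i := by
  classical
  have hset : ∀ p : Finset V → Prop, {F | p F}.ncard = #{F | p F} := fun p => by
    rw [← Set.ncard_coe_finset]; simp
  have hcount := sum_card_bipartiteAbove_eq_sum_card_bipartiteBelow
    (s := (univ : Finset V)) (t := ({F | H.IsFace F ∧ #F = i} : Finset (Finset V)))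
    (fun v F => v ∉ F)
  simp only [faceNumber_deleteVertex]
  simp only [faceNumber, hset]
  simp only [bipartiteAbove, bipartiteBelow, filter_filter] at hcount
  refine (Eq.trans (by congr!) hcount).trans ?_
  -- A face with `i` elements is counted once for each vertex of its complement.
  rw [sum_const_nat (m := Fintype.card V - i), mul_comm]
  · congr!
  intro F hF
  rw [← (mem_filter.1 hF).2.2, ← card_compl]
  congr 1
  ext; simp

lemma faceNumber_eq_zero_of_card_lt [Fintype V] (H : SimpleHypergraph V) {i : ℕ}
    (hi : Fintype.card V < i) : H.faceNumber i = 0 := by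
  rw [faceNumber, Set.ncard_eq_zero]
  ext F
  have := card_le_univ F
  simp only [Set.mem_ofPred_eq, Set.mem_empty_iff_false, iff_false, not_and]
  omega

lemma faceNumber_card [Fintype V] {H : SimpleHypergraph V} (hne : H.edges.Nonempty) :
    H.faceNumber (Fintype.card V) = 0 := by
  obtain ⟨e, he⟩ := hne
  rw [faceNumber, Set.ncard_eq_zero]
  ext F
  simp only [Set.mem_ofPred_eq, Set.mem_empty_iff_false, iff_false, not_and, card_eq_iff_eq_univ]
  rintro hF rfl
  exact hF e he (subset_univ e)

/-- An edge other than `V` misses some vertex `v`, so it survives in the card at `v` and is carried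
to an edge of `H'`. -/
lemma SameDeck.edges_nonempty [Fintype V] {H : SimpleHypergraph V} {H' : SimpleHypergraph V'}
    (h : H.SameDeck H') (hne : H.edges ≠ ∅) (huniv : H.edges ≠ {univ}) :
    H'.edges.Nonempty := by
  classical
  obtain ⟨e, he, heu⟩ : ∃ e ∈ H.edges, e ≠ univ := by
    by_contra! hall
    exact huniv (Set.eq_singleton_iff_nonempty_unique_mem.2
      ⟨Set.nonempty_iff_ne_empty.2 hne, hall⟩)
  obtain ⟨v, hv⟩ : ∃ v, v ∉ e := by simpa [eq_univ_iff_forall] using heu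
  obtain ⟨σ, hσ⟩ := h
  obtain ⟨φ, hφ⟩ := hσ v
  have hmap : (e.subtype (· ∈ ({v}ᶜ : Set V))).map
      (Function.Embedding.subtype (· ∈ ({v}ᶜ : Set V))) = e :=
    subtype_map_of_mem fun x hx => by rintro rfl; exact hv hx
  exact ⟨_, (hφ (e.subtype (· ∈ ({v}ᶜ : Set V)))).2 (by
    change _ ∈ H.edges
    rwa [hmap])⟩

lemma SameDeck.faceNumber_eq [Fintype V] [Fintype V'] {H : SimpleHypergraph V}
    {H' : SimpleHypergraph V'} (h : H.SameDeck H') (hne : H.edges ≠ ∅)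
    (huniv : H.edges ≠ {univ}) (i : ℕ) : H.faceNumber i = H'.faceNumber i := by
  have hne' := h.edges_nonempty hne huniv
  obtain ⟨σ, hσ⟩ := h
  have hcard := Fintype.card_congr σ
  -- Kelly's factor `n - i` can be cancelled only for `i < n`.
  rcases lt_trichotomy i (Fintype.card V) with hi | rfl | hi
  · refine Nat.eq_of_mul_eq_mul_left (Nat.sub_pos_of_lt hi) ?_
    rw [← sum_faceNumber_deleteVertex, hcard, ← sum_faceNumber_deleteVertex, ← σ.sum_comp]
    exact sum_congr rfl fun v _ => (hσ v).faceNumber_eq i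
  · rw [faceNumber_card (Set.nonempty_iff_ne_empty.2 hne), hcard, faceNumber_card hne']
  · rw [faceNumber_eq_zero_of_card_lt _ hi, faceNumber_eq_zero_of_card_lt _ (hcard ▸ hi)]

end Reconstruction

/-! ### The edge ideal as a monomial ideal. -/

section Algebra

variable (K : Type*) [Field K] (H : SimpleHypergraph V)

lemma edgeIdeal_eq_span_monomial : H.edgeIdeal K = Ideal.span
    ((fun m => monomial m (1 : K)) '' ((fun e : Finset V => ∑ v ∈ e, Finsupp.single v 1) ''
      H.edges)) := by
  rw [edgeIdeal, Set.image_image]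
  congr 1
  ext p
  simp only [Set.mem_ofPred_eq, Set.mem_image, monomial_sum_one, eq_comm]
  rfl

lemma mem_edgeIdeal_iff {p : MvPolynomial V K} :
    p ∈ H.edgeIdeal K ↔ ∀ m ∈ p.support, ¬ H.IsFace m.support := by
  classical
  rw [edgeIdeal_eq_span_monomial, mem_ideal_span_monomial_image]
  refine forall₂_congr fun m _ => ?_
  simp only [Set.exists_mem_image, IsFace, not_forall, not_not, exists_prop]
  refine exists_congr fun e => and_congr_right fun _ => ?_
  simp only [Finsupp.le_def, Finsupp.finsetSum_apply, Finsupp.single_apply, sum_ite_eq']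
  refine ⟨fun h v hv => ?_, fun h v => ?_⟩
  · have := h v
    rw [if_pos hv] at this
    exact Finsupp.mem_support_iff.2 (by omega)
  · split_ifs with hv
    · have := Finsupp.mem_support_iff.1 (h hv)
      omega
    · exact Nat.zero_le _

/-! ### Krull dimension as the largest size of a face. -/

section Dimension

/-- The projection of `K[x_v : v ∈ V]` to the polynomial ring on the variables in `F`. -/
noncomputable def projFace (F : Finset V) : MvPolynomial V K →ₐ[K] MvPolynomial F K :=
  open Classical in aeval fun v => if h : v ∈ F then X ⟨v, h⟩ else 0

variable {K} in
lemma projFace_X_of_mem {F : Finset V} {v : V} (hv : v ∈ F) :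
    projFace K F (X v) = X ⟨v, hv⟩ := by
  simp [projFace, hv]

variable {K} in
lemma projFace_X_of_notMem {F : Finset V} {v : V} (hv : v ∉ F) :
    projFace K F (X v) = 0 := by
  simp [projFace, hv]

lemma projFace_surjective (F : Finset V) : Function.Surjective (projFace K F) := by
  intro p
  refine ⟨rename (↑) p, ?_⟩
  have : (projFace K F).comp (rename (↑)) = AlgHom.id K _ := by
    ext v : 1
    simp [projFace_X_of_mem v.2]
  exact DFunLike.congr_fun this p

variable {H} in
lemma IsFace.edgeIdeal_le_ker {F : Finset V} (hF : H.IsFace F) :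
    H.edgeIdeal K ≤ RingHom.ker (projFace K F) := by
  rw [edgeIdeal, Ideal.span_le]
  rintro _ ⟨e, he, rfl⟩
  obtain ⟨v, hv, hvF⟩ := not_subset.1 (hF e he)
  rw [SetLike.mem_coe, RingHom.mem_ker, map_prod]
  exact prod_eq_zero hv (projFace_X_of_notMem hvF)

lemma ringKrullDim_mvPolynomial_finset (F : Finset V) :
    ringKrullDim (MvPolynomial F K) = #F := by
  rw [MvPolynomial.ringKrullDim_of_isNoetherianRing, ringKrullDim_eq_zero_of_field]
  simp

variable {H} in
lemma IsFace.card_le_ringKrullDim {F : Finset V} (hF : H.IsFace F) :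
    (#F : WithBot ℕ∞) ≤ ringKrullDim (H.EdgeRing K) := by
  rw [← ringKrullDim_mvPolynomial_finset K F]
  exact ringKrullDim_le_of_surjective
    (Ideal.Quotient.lift (H.edgeIdeal K) (projFace K F).toRingHom (hF.edgeIdeal_le_ker K))
    (Ideal.Quotient.lift_surjective_of_surjective _ _ (projFace_surjective K F))

/-- A chain of primes starting at `P` is a chain in the spectrum of `R ⧸ P`. -/
lemma _root_.ringKrullDim_le_of_forall_isPrime {R : Type*} [CommRing R] {d : WithBot ℕ∞}
    (h : ∀ P : Ideal R, P.IsPrime → ringKrullDim (R ⧸ P) ≤ d) : ringKrullDim R ≤ d := by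
  refine iSup_le fun p => le_trans ?_ (h p.head.asIdeal p.head.isPrime)
  rw [ringKrullDim_quotient]
  let q : LTSeries (PrimeSpectrum.zeroLocus (p.head.asIdeal : Set R)) :=
    LTSeries.mk p.length (fun i => ⟨p i, LTSeries.head_le p i⟩)
      fun i j hij => p.strictMono hij
  exact Order.LTSeries.length_le_krullDim q

/-- In a domain quotient of `R` the variables with nonzero image form a face, and they generate the
quotient as an algebra. -/
lemma ringKrullDim_edgeRing_le [Fintype V] {d : ℕ} (hd : ∀ F, H.IsFace F → #F ≤ d) :
    ringKrullDim (H.EdgeRing K) ≤ d := by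
  classical
  refine ringKrullDim_le_of_forall_isPrime fun P hP => ?_
  let f : MvPolynomial V K →ₐ[K] H.EdgeRing K ⧸ P :=
    (Ideal.Quotient.mkₐ K P).comp (Ideal.Quotient.mkₐ K (H.edgeIdeal K))
  have hf : Function.Surjective f :=
    (Ideal.Quotient.mkₐ_surjective K P).comp (Ideal.Quotient.mkₐ_surjective K _)
  let F : Finset V := {v | f (X v) ≠ 0}
  have hF : H.IsFace F := by
    intro e he heF
    have hzero : f (∏ v ∈ e, X v) = 0 := by
      have : Ideal.Quotient.mkₐ K (H.edgeIdeal K) (∏ v ∈ e, X v) = 0 :=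
        Ideal.Quotient.eq_zero_iff_mem.2 (Ideal.subset_span ⟨e, he, rfl⟩)
      simp only [f, AlgHom.comp_apply, this, map_zero]
    -- Primality of `P` enters here: some variable of the edge vanishes in the quotient.
    rw [map_prod, prod_eq_zero_iff] at hzero
    obtain ⟨v, hv, hv0⟩ := hzero
    exact (mem_filter.1 (heF hv)).2 hv0
  let g : MvPolynomial F K →ₐ[K] H.EdgeRing K ⧸ P := aeval fun v => f (X v)
  have hgf : g.comp (projFace K F) = f := by
    ext v : 1
    by_cases hv : v ∈ F
    · simp [projFace_X_of_mem hv, g]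
    · have : f (X v) = 0 := by simpa [F] using hv
      simp [projFace_X_of_notMem hv, this]
  have hg : Function.Surjective g :=
    Function.Surjective.of_comp (g := projFace K F) (by rw [← AlgHom.coe_comp, hgf]; exact hf)
  calc ringKrullDim (H.EdgeRing K ⧸ P) ≤ ringKrullDim (MvPolynomial F K) :=
        ringKrullDim_le_of_surjective g.toRingHom hg
    _ = #F := ringKrullDim_mvPolynomial_finset K F
    _ ≤ d := by exact_mod_cast hd F hF

lemma subsingleton_edgeRing_iff [Fintype V] :
    Subsingleton (H.EdgeRing K) ↔ ∀ i, H.faceNumber i = 0 := by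
  rw [Ideal.Quotient.subsingleton_iff, Ideal.eq_top_iff_one, mem_edgeIdeal_iff]
  have h1 : (1 : MvPolynomial V K).support = {0} := by
    simp
  simp only [h1, mem_singleton, forall_eq, Finsupp.support_zero]
  constructor
  · intro h i
    rw [faceNumber, Set.ncard_eq_zero]
    exact Set.eq_empty_of_forall_notMem fun F hF => h (hF.1.mono (empty_subset F))
  · intro h hface
    have := h 0
    rw [faceNumber, Set.ncard_eq_zero] at this
    exact Set.eq_empty_iff_forall_notMem.1 this ∅ ⟨hface, rfl⟩

lemma ringKrullDim_edgeRing_eq [Fintype V] {d : ℕ}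
    (hd : IsGreatest {i | H.faceNumber i ≠ 0} d) : ringKrullDim (H.EdgeRing K) = d := by
  refine le_antisymm (H.ringKrullDim_edgeRing_le K fun F hF => hd.2 ?_) ?_
  · exact (Set.ncard_ne_zero_of_mem (a := F) ⟨hF, rfl⟩)
  · obtain ⟨F, hF, rfl⟩ := Set.nonempty_of_ncard_ne_zero hd.1
    exact hF.card_le_ringKrullDim K

end Dimension

/-! ### The Hilbert series in terms of face numbers. -/

section HilbertSeries

lemma gradedPiece_eq_span (i : ℕ) : H.gradedPiece K i = Submodule.span K (Set.range
    fun m : {m : V →₀ ℕ // m.degree = i ∧ H.IsFace m.support} =>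
      Ideal.Quotient.mkₐ K (H.edgeIdeal K) (monomial m.1 1)) := by
  apply le_antisymm
  · rintro _ ⟨p, hp, rfl⟩
    rw [AlgHom.toLinearMap_apply, p.as_sum, map_sum]
    refine Submodule.sum_mem _ fun m hm => ?_
    rw [← mul_one (coeff m p), ← smul_eq_mul, ← smul_monomial, map_smul]
    refine Submodule.smul_mem _ _ ?_
    by_cases hface : H.IsFace m.support
    · exact Submodule.subset_span ⟨⟨m, by
        rw [Finsupp.degree_eq_weight_one]; exact hp (mem_support_iff.1 hm), hface⟩, rfl⟩
    · have : Ideal.Quotient.mkₐ K (H.edgeIdeal K) (monomial m 1) = 0 :=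
        Ideal.Quotient.eq_zero_iff_mem.2 ((H.mem_edgeIdeal_iff K).2 fun n hn => by
          rwa [mem_singleton.1 (support_monomial_subset hn)])
      rw [this]
      exact Submodule.zero_mem _
  · rw [Submodule.span_le]
    rintro _ ⟨m, rfl⟩
    exact ⟨_, isHomogeneous_monomial 1 m.2.1, rfl⟩

/-- A combination lying in the monomial ideal involves only monomials whose supports are not faces.
-/
lemma linearIndependent_mk_monomial (i : ℕ) : LinearIndependent K
    fun m : {m : V →₀ ℕ // m.degree = i ∧ H.IsFace m.support} =>
      Ideal.Quotient.mkₐ K (H.edgeIdeal K) (monomial m.1 1) := by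
  classical
  rw [linearIndependent_iff']
  intro s c hc m hm
  simp only [← map_smul, ← map_sum] at hc
  have hmem := (H.mem_edgeIdeal_iff K).1 (Ideal.Quotient.eq_zero_iff_mem.1 hc) m.1
  by_contra hcm
  refine hmem (mem_support_iff.2 ?_) m.2.2
  simpa [coeff_sum, coeff_monomial, Subtype.coe_inj, hm] using hcm

lemma finrank_gradedPiece [Fintype V] (i : ℕ) : Module.finrank K (H.gradedPiece K i) =
    {m : V →₀ ℕ | m.degree = i ∧ H.IsFace m.support}.ncard := by
  classical
  have hfin : {m : V →₀ ℕ | m.degree = i ∧ H.IsFace m.support}.Finite := by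
    refine (finite_toSet (finsuppAntidiag univ i)).subset fun m hm => ?_
    simp [← hm.1, Finsupp.degree_eq_sum]
  have : Fintype {m : V →₀ ℕ // m.degree = i ∧ H.IsFace m.support} := hfin.fintype
  rw [gradedPiece_eq_span, finrank_span_eq_card (H.linearIndependent_mk_monomial K i),
    ← Nat.card_eq_fintype_card]
  rfl

/-- The monomials with support `F` are counted by `(t / (1 - t)) ^ #F`. -/
lemma coeff_X_mul_mk_one_pow [DecidableEq V] (F : Finset V) (i : ℕ) :
    PowerSeries.coeff i ((PowerSeries.X * PowerSeries.mk 1 : PowerSeries ℤ) ^ #F) =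
      #{m ∈ finsuppAntidiag F i | m.support = F} := by
  have hcoeff : ∀ n, PowerSeries.coeff n (PowerSeries.X * PowerSeries.mk 1 : PowerSeries ℤ) = if n ≠ 0 then 1 else 0 := by
    rintro (_ | n)
    · simp
    · simp [PowerSeries.coeff_succ_X_mul]
  -- One factor `t + t² + ⋯` per vertex of `F` forces every exponent to be positive.
  rw [← prod_const, PowerSeries.coeff_prod, card_filter]
  push_cast
  refine sum_congr rfl fun m hm => ?_
  simp only [hcoeff, prod_ite_zero, prod_const_one]
  refine if_congr ?_ rfl rfl
  refine ⟨fun h => (mem_finsuppAntidiag.1 hm).2.antisymm fun v hv =>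
    Finsupp.mem_support_iff.2 (h v hv), ?_⟩
  rintro rfl v hv
  exact Finsupp.mem_support_iff.1 hv

lemma hilbertSeries_eq [Fintype V] : H.hilbertSeries K =
    ∑ j ∈ range (Fintype.card V + 1), (H.faceNumber j : PowerSeries ℤ) * (PowerSeries.X * PowerSeries.mk 1) ^ j := by
  classical
  have hface : ∀ j, H.faceNumber j = #{F : Finset V | H.IsFace F ∧ #F = j} := fun j => by
    rw [faceNumber, ← Set.ncard_coe_finset]; simp
  have hfaces : ∑ j ∈ range (Fintype.card V + 1),
      (H.faceNumber j : PowerSeries ℤ) * (PowerSeries.X * PowerSeries.mk 1) ^ j =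
      ∑ F : Finset V with H.IsFace F, (PowerSeries.X * PowerSeries.mk 1 : PowerSeries ℤ) ^ #F := by
    rw [← sum_fiberwise_of_maps_to (g := Finset.card) (t := range (Fintype.card V + 1))
      (fun F _ => mem_range.2 (Nat.lt_succ_of_le (card_le_univ F)))]
    refine sum_congr rfl fun j _ => ?_
    rw [hface, filter_filter, ← nsmul_eq_mul, ← sum_const]
    exact sum_congr rfl fun F hF => by rw [(mem_filter.1 hF).2.2]
  rw [hfaces]
  ext i
  rw [hilbertSeries, PowerSeries.coeff_mk, finrank_gradedPiece, map_sum]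
  simp only [coeff_X_mul_mk_one_pow]
  have hset : {m : V →₀ ℕ | m.degree = i ∧ H.IsFace m.support} =
      ({m ∈ finsuppAntidiag univ i | H.IsFace m.support} : Finset (V →₀ ℕ)) := by
    ext m
    simp [Finsupp.degree_eq_sum]
  -- Monomials are sorted by their support.
  rw [hset, Set.ncard_coe_finset, card_eq_sum_card_fiberwise (f := Finsupp.support)
    (t := {F : Finset V | H.IsFace F}) (fun m hm => by simpa using (mem_filter.1 hm).2)]
  push_cast
  refine sum_congr rfl fun F hF => ?_
  congr 2
  ext m
  simp only [mem_filter, mem_finsuppAntidiag, subset_univ, and_true]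
  refine ⟨fun ⟨⟨h1, h2⟩, h3⟩ => ⟨⟨?_, h3.subset⟩, h3⟩,
    fun ⟨⟨h1, h2⟩, h3⟩ => ⟨⟨?_, h3 ▸ (mem_filter.1 hF).2⟩, h3⟩⟩
  · rw [← h1]
    exact sum_subset (subset_univ _) fun v _ hv => by simpa [← h3] using hv
  · rw [← h1]
    exact (sum_subset (subset_univ _) fun v _ hv => by simpa [← h3] using hv).symm

lemma exists_one_sub_X_pow_mul_hilbertSeries [Fintype V] {d : ℕ}
    (hd : ∀ i, d < i → H.faceNumber i = 0) :
    ∃ Q : Polynomial ℤ, (1 - PowerSeries.X) ^ d * H.hilbertSeries K = (Q : PowerSeries ℤ) := by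
  -- The truncation of `d - j` for `j > d` is harmless, since those face numbers vanish.
  refine ⟨∑ j ∈ range (Fintype.card V + 1),
    (H.faceNumber j : Polynomial ℤ) * (Polynomial.X ^ j * (1 - Polynomial.X) ^ (d - j)), ?_⟩
  rw [hilbertSeries_eq, ← Polynomial.coeToPowerSeries.ringHom_apply, map_sum, mul_sum]
  refine sum_congr rfl fun j _ => ?_
  simp only [map_mul, map_natCast, map_pow, map_sub, map_one,
    Polynomial.coeToPowerSeries.ringHom_apply, Polynomial.coe_X]
  by_cases hj : d < j
  · simp [hd j hj]
  · have hinv : ((1 - PowerSeries.X) * PowerSeries.mk 1 : PowerSeries ℤ) = 1 := by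
      rw [mul_comm, PowerSeries.mk_one_mul_one_sub_eq_one]
    obtain ⟨k, rfl⟩ := Nat.exists_eq_add_of_le (not_lt.1 hj)
    calc (1 - PowerSeries.X) ^ (j + k) * ((H.faceNumber j : PowerSeries ℤ) * (PowerSeries.X * PowerSeries.mk 1) ^ j)
        = (H.faceNumber j : PowerSeries ℤ) * (PowerSeries.X ^ j * (1 - PowerSeries.X) ^ k) * ((1 - PowerSeries.X) * PowerSeries.mk 1) ^ j := by
          rw [mul_pow, mul_pow, pow_add]; ring
      _ = _ := by simp [hinv]

end HilbertSeries

/-! ### Multiplicity, and comparison of two hypergraphs. -/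

lemma subsingleton_edgeRing_or_exists_isGreatest [Fintype V] :
    Subsingleton (H.EdgeRing K) ∨ ∃ d, IsGreatest {i | H.faceNumber i ≠ 0} d := by
  rw [subsingleton_edgeRing_iff, or_iff_not_imp_left]
  intro h
  push Not at h
  exact ⟨_, Nat.sSup_mem h ⟨Fintype.card V, fun i hi => not_lt.1 fun hlt =>
    hi (H.faceNumber_eq_zero_of_card_lt hlt)⟩, fun i hi => le_csSup
    ⟨Fintype.card V, fun i hi => not_lt.1 fun hlt =>
    hi (H.faceNumber_eq_zero_of_card_lt hlt)⟩ hi⟩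

lemma existsUnique_isMultiplicity [Fintype V] : ∃! e : ℤ, H.IsMultiplicity K e := by
  rcases H.subsingleton_edgeRing_or_exists_isGreatest K with h | ⟨d, hd⟩
  · refine ⟨0, Or.inl ⟨h, rfl⟩, ?_⟩
    rintro e (⟨-, he⟩ | ⟨d, hd, -⟩)
    · exact he
    -- The zero ring has dimension `⊥`, so the two cases of the definition exclude each other.
    · simp [ringKrullDim_eq_bot_of_subsingleton] at hd
  · have hdim := H.ringKrullDim_edgeRing_eq K hd
    obtain ⟨Q, hQ⟩ := H.exists_one_sub_X_pow_mul_hilbertSeries K (d := d)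
      fun i hi => by_contra fun h => hi.not_ge (hd.2 h)
    refine ⟨Q.eval 1, Or.inr ⟨d, hdim, Q, hQ, rfl⟩, ?_⟩
    rintro e (⟨h, -⟩ | ⟨d', hd', Q', hQ', rfl⟩)
    · simp [ringKrullDim_eq_bot_of_subsingleton] at hdim
    · obtain rfl : d = d' := by exact_mod_cast hdim.symm.trans hd'
      rw [Polynomial.coe_injective ℤ (hQ'.symm.trans hQ)]

variable {H} in
lemma ringKrullDim_edgeRing_congr [Fintype V] [Fintype V'] {H' : SimpleHypergraph V'}
    (h : ∀ i, H.faceNumber i = H'.faceNumber i) :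
    ringKrullDim (H.EdgeRing K) = ringKrullDim (H'.EdgeRing K) := by
  rcases H.subsingleton_edgeRing_or_exists_isGreatest K with hs | ⟨d, hd⟩
  · have hs' : Subsingleton (H'.EdgeRing K) := by
      simpa only [subsingleton_edgeRing_iff, h] using hs
    rw [ringKrullDim_eq_bot_of_subsingleton, ringKrullDim_eq_bot_of_subsingleton]
  · rw [H.ringKrullDim_edgeRing_eq K hd, H'.ringKrullDim_edgeRing_eq K (by simpa only [h] using hd)]

end Algebra

end SimpleHypergraph

theorem corollary4p6 {V : Type*} {V' : Type*} [Fintype V] [Fintype V'] (K : Type*) [Field K]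
    (H : SimpleHypergraph V) (H' : SimpleHypergraph V')
    (hn : 3 ≤ Fintype.card V)
    (hne : H.edges ≠ ∅) (huniv : H.edges ≠ {Finset.univ})
    (hdeck : H.SameDeck H') :
    ringKrullDim (H.EdgeRing K) = ringKrullDim (H'.EdgeRing K) ∧
    (∃! e : ℤ, H.IsMultiplicity K e) ∧
    (∀ e : ℤ, H.IsMultiplicity K e ↔ H'.IsMultiplicity K e) := by
  have hface := hdeck.faceNumber_eq hne huniv
  have hcard : Fintype.card V = Fintype.card V' := Fintype.card_congr hdeck.choose
  have hdim := SimpleHypergraph.ringKrullDim_edgeRing_congr K hface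
  refine ⟨hdim, H.existsUnique_isMultiplicity K, fun e => ?_⟩
  have hseries : H.hilbertSeries K = H'.hilbertSeries K := by
    simp only [SimpleHypergraph.hilbertSeries_eq, hcard, hface]
  simp only [SimpleHypergraph.IsMultiplicity, SimpleHypergraph.subsingleton_edgeRing_iff, hdim,
    hseries, hface]
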